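/- Let $d\ge 1$, let $U\in\mathbb R^{n\times d}$ satisfy $U^TU=I$ (so $n\ge d$), and let $\sigma_c>0$, $\sigma_z\ge 0$, $\varepsilon\ge 0$ with $\varepsilon^2<\sigma_c^2$. The signal is $x=Uc$ with $c\sim\mathcal N(0,\frac{\sigma_c^2}{d}I)$ and the measurement is $y=x+z$ with $z\sim\mathcal N(0,\frac{\sigma_z^2}{n}I)$ independent of $c$. For a symmetric matrix $H\in\mathbb R^{n\times n}$, identified with the estimator $f(y)=Hy$, put $$R_\varepsilon(H)=\mathbb E\Big[\max_{\|e\|_2\le\varepsilon}\|H(y+e)-x\|_2^2\Big],\qquad J_{\sigma_w}(H)=\mathbb E\big[\|H(y+w)-x\|_2^2\big],$$ where $w\sim\mathcal N(0,\sigma_w^2I)$ is independent of $(c,z)$. Choose the jittering noise level $$\sigma_w=\sigma_w(\varepsilon)=\sqrt{\frac{\varepsilon^2\sigma_z^2\frac dn+\sigma_z\sqrt{\frac dn}\,\sigma_c\,\varepsilon\sqrt{\sigma_c^2-\varepsilon^2+\sigma_z^2\frac dn}}{d(\sigma_c^2-\varepsilon^2)}}.$$ Then: 1. The matrix $H_j=\alpha_j\,UU^T$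 with $\alpha_j=\dfrac{\sigma_c^2}{\sigma_c^2+\sigma_z^2\frac dn+\sigma_w^2d}$ minimizes $J_{\sigma_w}$ among all symmetric matrices, and it is the only minimizer if $\sigma_z>0$. 2. $\alpha_j=\dfrac{\sigma_c^2-\dfrac{\varepsilon\sigma_c\sigma_z\sqrt{d/n}}{\sqrt{\sigma_c^2+\sigma_z^2\frac dn-\varepsilon^2}}}{\sigma_c^2+\sigma_z^2\frac dn}$, the shrinkage factor of the worst-case optimal estimator. 3. For $d\to\infty$, $H_j$ also minimizes the worst-case risk $R_\varepsilon$ among all symmetric matrices, in the following sense: for every $\delta>0$ there is a $D$, depending only on $\delta$, such that whenever $d\ge D$, $$R_\varepsilon(H_j)\le(1+\delta)\,R_\varepsilon(H)\qquad\text{for every symmetric } H\in\mathbb R^{n\times n}.$$ -/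

import Mathlib

open MeasureTheory ProbabilityTheory
open scoped ENNReal

namespace RobustDenoising

/-- The centred Gaussian law `N(0, v I)` on `ℝ^k`. -/
noncomputable def isoGaussian (k : ℕ) (v : ℝ) : Measure (EuclideanSpace ℝ (Fin k)) :=
  multivariateGaussian 0 (v • (1 : Matrix (Fin k) (Fin k) ℝ))

/-- The joint law of the independent pair `(c, z)` of the latent code `c ∼ N(0, σc² / d I)` in `ℝ^d`
and the measurement noise `z ∼ N(0, σz² / n I)` in `ℝ^n`. -/
noncomputable def latentNoiseLaw (d n : ℕ) (σc σz : ℝ) :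
    Measure (EuclideanSpace ℝ (Fin d) × EuclideanSpace ℝ (Fin n)) :=
  (isoGaussian d (σc ^ 2 / d)).prod (isoGaussian n (σz ^ 2 / n))

/-- The robust risk `E [max_{‖e‖ ≤ ε} ‖f (y + e) - x‖²]` of an estimator `f` of the signal `x = U c`
from the measurement `y = x + z`, as an expectation with values in `[0, ∞]`. -/
noncomputable def robustRisk {d n : ℕ} (U : Matrix (Fin n) (Fin d) ℝ) (σc σz ε : ℝ)
    (f : EuclideanSpace ℝ (Fin n) → EuclideanSpace ℝ (Fin n)) : ℝ≥0∞ :=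
  ∫⁻ p, ⨆ e ∈ Metric.closedBall (0 : EuclideanSpace ℝ (Fin n)) ε,
    ‖f (U.toEuclideanLin p.1 + p.2 + e) - U.toEuclideanLin p.1‖ₑ ^ 2
    ∂(latentNoiseLaw d n σc σz)

/-- The jittering risk `E [‖f (y + w) - x‖²]` of an estimator `f` of the signal `x = U c`
from the measurement `y = x + z`, with independent jittering noise `w ∼ N(0, σw² I)`. -/
noncomputable def jitteringRisk {d n : ℕ} (U : Matrix (Fin n) (Fin d) ℝ) (σc σz σw : ℝ)
    (f : EuclideanSpace ℝ (Fin n) → EuclideanSpace ℝ (Fin n)) : ℝ≥0∞ :=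
  ∫⁻ p, ‖f (U.toEuclideanLin p.1.1 + p.1.2 + p.2) - U.toEuclideanLin p.1.1‖ₑ ^ 2
    ∂((latentNoiseLaw d n σc σz).prod (isoGaussian n (σw ^ 2)))

/-- The linear estimator `f(y) = H y`. -/
noncomputable def linearEstimator {n : ℕ} (H : Matrix (Fin n) (Fin n) ℝ) :
    EuclideanSpace ℝ (Fin n) → EuclideanSpace ℝ (Fin n) :=
  fun y => H.toEuclideanLin y

/-- `H` is symmetric, and the estimator `f(y) = H y` minimizes the jittering risk among all
estimators given by symmetric matrices. -/
def IsJitteringMinimizer {d n : ℕ} (U : Matrix (Fin n) (Fin d) ℝ) (σc σz σw : ℝ)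
    (H : Matrix (Fin n) (Fin n) ℝ) : Prop :=
  H.IsSymm ∧ IsMinOn (fun H' : Matrix (Fin n) (Fin n) ℝ =>
    jitteringRisk U σc σz σw (linearEstimator H')) {H' | H'.IsSymm} H

/-- The jittering noise level `σ_w(ε)`. -/
noncomputable def jitterLevel (d n : ℕ) (σc σz ε : ℝ) : ℝ :=
  √((ε ^ 2 * σz ^ 2 * (d / n) +
      σz * √(d / n) * σc * ε * √(σc ^ 2 - ε ^ 2 + σz ^ 2 * (d / n))) /
    (d * (σc ^ 2 - ε ^ 2)))

/-- The shrinkage factor of the jittering estimator. -/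
noncomputable def jitterShrinkage (d n : ℕ) (σc σz σw : ℝ) : ℝ :=
  σc ^ 2 / (σc ^ 2 + σz ^ 2 * (d / n) + σw ^ 2 * d)

/-- The shrinkage factor of the worst-case optimal estimator in the regime `ε² < σc²`. -/
noncomputable def robustShrinkage (d n : ℕ) (σc σz ε : ℝ) : ℝ :=
  (σc ^ 2 - ε * σc * σz * √(d / n) / √(σc ^ 2 + σz ^ 2 * (d / n) - ε ^ 2)) /
    (σc ^ 2 + σz ^ 2 * (d / n))

end RobustDenoising

/-! Jittering. The error splits into independent centred parts, so the jittering risk is a quadratic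
`κ‖(H - 1)U‖² + l‖H‖²` in Frobenius norms. Completing the square at the stationary multiple of `U
Uᵀ` gives the minimizer (`frobSq_completing_square`). That its factor equals the robust one is
algebra.

Worst case. Put `s(α) = shrinkError` and `K = gaussianSquareVariance`. Two bounds enclose the risk.
Above, for `a ≥ 0`, the risk of `a U Uᵀ` is at most `(s(a) + aε)²`: an attack adds at most `aε` to
the error norm, whose law is that of an isotropic Gaussian's norm. Below, every `H` has risk at
least `(1 - K/(2d)) (s(α) + |α|ε)²`, where `α` is the normalized trace of `Uᵀ H U`
(`le_lintegral_linear`). The attack used against `H` is the one optimal against `α U Uᵀ`; it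
commutes with rotations of the signal space, so on average, tested against the attacked residual of
`α U Uᵀ`, `H` acts as the scalar `α` (Schur's lemma). The factor comes from concentration of the
Gaussian norm. The robust shrinkage factor minimizes `s(α) + |α|ε` by Cauchy–Schwarz
(`robustShrinkage_optimal`), so the two bounds differ by the factor `1 - K/(2d)` alone, and `d`
large in terms of `δ` suffices. -/

namespace RobustDenoising

open scoped RealInnerProductSpace

/-! ### Isotropic Gaussian laws and their norm moments -/

instance isGaussian_isoGaussian (k : ℕ) (v : ℝ) : IsGaussian (isoGaussian k v) := by
  unfold isoGaussian; infer_instance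

lemma charFun_isoGaussian {k : ℕ} {v : ℝ} (hv : 0 ≤ v) (t : EuclideanSpace ℝ (Fin k)) :
    charFun (isoGaussian k v) t = Complex.exp (-(v * ‖t‖ ^ 2 / 2 : ℝ)) := by
  rw [isoGaussian, charFun_multivariateGaussian (Matrix.PosSemidef.one.smul hv)]
  simp only [inner_zero_right, EuclideanSpace.real_norm_sq_eq, Matrix.smul_mulVec,
    Matrix.one_mulVec, dotProduct]
  push_cast
  congr 1
  simp [Finset.mul_sum, sq, Finset.sum_div, mul_left_comm]

/-- The characteristic function depends on `‖t‖` only. Asking that the adjoint preserve norms covers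
rotations and reflections, and also the non-injective compression of the noise to the signal space.
-/
lemma isoGaussian_map_of_norm_adjoint {k m : ℕ} {v : ℝ} (hv : 0 ≤ v)
    (L : EuclideanSpace ℝ (Fin k) →L[ℝ] EuclideanSpace ℝ (Fin m))
    (hL : ∀ t, ‖L.adjoint t‖ = ‖t‖) : (isoGaussian k v).map L = isoGaussian m v := by
  have := Measure.isProbabilityMeasure_map (μ := isoGaussian k v) (f := L) (by fun_prop)
  apply Measure.ext_of_charFun
  ext t
  rw [charFun_isoGaussian hv, ← hL t, ← charFun_isoGaussian hv, charFun_apply, charFun_apply,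
    integral_map (by fun_prop) (by fun_prop)]
  simp_rw [ContinuousLinearMap.adjoint_inner_right]

lemma isoGaussian_prod_map_add {k : ℕ} {v w : ℝ} (hv : 0 ≤ v) (hw : 0 ≤ w) (p q : ℝ) :
    ((isoGaussian k v).prod (isoGaussian k w)).map (fun x => p • x.1 + q • x.2) =
      isoGaussian k (p ^ 2 * v + q ^ 2 * w) := by
  have := Measure.isProbabilityMeasure_map (μ := (isoGaussian k v).prod (isoGaussian k w))
    (f := fun x => p • x.1 + q • x.2) (by fun_prop)
  apply Measure.ext_of_charFun
  ext t
  have h1 := charFun_isoGaussian hv (p • t)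
  have h2 := charFun_isoGaussian hw (q • t)
  rw [charFun_isoGaussian (by positivity), charFun_apply, integral_map (by fun_prop) (by fun_prop)]
  rw [charFun_apply] at h1 h2
  simp_rw [inner_smul_right] at h1 h2
  simp_rw [inner_add_left, inner_smul_left, Complex.ofReal_add, add_mul, Complex.exp_add]
  simp only [conj_trivial]
  rw [integral_prod_mul (fun x : EuclideanSpace ℝ (Fin k) => Complex.exp ((p * ⟪x, t⟫ : ℝ) * Complex.I))
    (fun x : EuclideanSpace ℝ (Fin k) => Complex.exp ((q * ⟪x, t⟫ : ℝ) * Complex.I)), h1, h2,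
    ← Complex.exp_add]
  congr 1
  simp only [norm_smul, mul_pow, Real.norm_eq_abs, sq_abs]
  push_cast
  ring

lemma isoGaussian_eq_map_stdGaussian {k : ℕ} {v : ℝ} (hv : 0 ≤ v) :
    isoGaussian k v = (stdGaussian (EuclideanSpace ℝ (Fin k))).map (fun x => √v • x) := by
  have := Measure.isProbabilityMeasure_map (μ := stdGaussian (EuclideanSpace ℝ (Fin k)))
    (f := fun x => √v • x) (by fun_prop)
  apply Measure.ext_of_charFun
  ext t
  rw [charFun_isoGaussian hv, charFun_map_smul, charFun_stdGaussian, norm_smul]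
  congr 1
  simp [mul_pow, ← Complex.ofReal_pow, hv, neg_div]

/-- The variance of the square of a standard normal variable. -/
noncomputable def gaussianSquareVariance : ℝ := Var[fun x => x ^ 2; gaussianReal 0 1]

lemma gaussianSquareVariance_nonneg : 0 ≤ gaussianSquareVariance := variance_nonneg _ _

lemma memLp_sq_gaussianReal : MemLp (fun x : ℝ => x ^ 2) 2 (gaussianReal 0 1) := by
  rw [memLp_two_iff_integrable_sq (by fun_prop)]
  have := (memLp_id_gaussianReal (μ := 0) (v := 1) 4).integrable_norm_pow (p := 4) (by norm_num)
  refine this.congr (ae_of_all _ fun x => ?_)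
  simp [← pow_mul, Even.pow_abs (show Even 4 by decide)]

lemma integral_sq_gaussianReal : ∫ x, x ^ 2 ∂(gaussianReal 0 1) = 1 := by
  have h := variance_fun_id_gaussianReal (μ := 0) (v := 1)
  rw [variance_of_integral_eq_zero (by fun_prop) (by simp)] at h
  simpa using h

lemma integral_norm_sq_stdGaussian (k : ℕ) :
    ∫ x, ‖x‖ ^ 2 ∂(stdGaussian (EuclideanSpace ℝ (Fin k))) = k := by
  rw [← map_pi_eq_stdGaussian, integral_map (by fun_prop) (by fun_prop)]
  simp_rw [EuclideanSpace.real_norm_sq_eq]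
  rw [integral_finsetSum]
  · have (i : Fin k) := integral_comp_eval (μ := fun _ : Fin k => gaussianReal 0 1) (i := i)
      (f := fun x : ℝ => x ^ 2) (by fun_prop)
    simp_rw [this, integral_sq_gaussianReal]
    simp
  · intro i _
    exact integrable_comp_eval (μ := fun _ : Fin k => gaussianReal 0 1) (i := i)
      (f := fun x : ℝ => x ^ 2) (memLp_sq_gaussianReal.integrable (by norm_num))

lemma integral_norm_pow_four_stdGaussian (k : ℕ) :
    ∫ x, ‖x‖ ^ 4 ∂(stdGaussian (EuclideanSpace ℝ (Fin k))) =
      k ^ 2 + gaussianSquareVariance * k := by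
  have hm := integral_norm_sq_stdGaussian k
  have hL : MemLp (fun x : EuclideanSpace ℝ (Fin k) => ‖x‖ ^ 2) 2
      (stdGaussian (EuclideanSpace ℝ (Fin k))) := by
    rw [memLp_two_iff_integrable_sq (by fun_prop)]
    have := (IsGaussian.memLp_id (stdGaussian (EuclideanSpace ℝ (Fin k))) 4
      (by norm_num)).integrable_norm_pow (p := 4) (by norm_num)
    refine this.congr (ae_of_all _ fun x => ?_)
    simp [← pow_mul]
  have hv : Var[fun x : EuclideanSpace ℝ (Fin k) => ‖x‖ ^ 2;
      stdGaussian (EuclideanSpace ℝ (Fin k))] = gaussianSquareVariance * k := by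
    rw [← map_pi_eq_stdGaussian, variance_map (by fun_prop) (by fun_prop)]
    have := variance_sum_pi (μ := fun _ : Fin k => gaussianReal 0 1)
      (X := fun _ : Fin k => fun x : ℝ => x ^ 2) (fun _ => memLp_sq_gaussianReal)
    rw [show (fun x : EuclideanSpace ℝ (Fin k) => ‖x‖ ^ 2) ∘ WithLp.toLp 2 =
      ∑ i : Fin k, fun ω : Fin k → ℝ => (ω i) ^ 2 by
        ext x; simp [EuclideanSpace.real_norm_sq_eq], this]
    simp [gaussianSquareVariance, mul_comm]
  rw [variance_eq_sub hL, hm] at hv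
  have h4 : (fun x : EuclideanSpace ℝ (Fin k) => ‖x‖ ^ 2) ^ 2 = fun x => ‖x‖ ^ 4 := by
    ext x; simp [← pow_mul]
  rw [h4] at hv
  linarith

/-- A lower bound for `‖x‖` by a polynomial in `‖x‖²`, touching at `‖x‖ = √k`, reduces the claim to
the second and fourth moments. Only the finiteness of `gaussianSquareVariance` matters, not its
value. -/
lemma le_integral_norm_stdGaussian {k : ℕ} (hk : 0 < k) :
    (1 - gaussianSquareVariance / (2 * k)) * √k ≤
      ∫ x, ‖x‖ ∂(stdGaussian (EuclideanSpace ℝ (Fin k))) := by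
  have hk' : (0 : ℝ) < k := by exact_mod_cast hk
  have hs : 0 < √(k : ℝ) := Real.sqrt_pos.2 hk'
  have hss : √(k : ℝ) ^ 2 = k := Real.sq_sqrt hk'.le
  have hI (p : ℕ) (hp : p ≠ 0) : Integrable (fun x : EuclideanSpace ℝ (Fin k) => ‖x‖ ^ p)
      (stdGaussian (EuclideanSpace ℝ (Fin k))) :=
    (IsGaussian.memLp_id (stdGaussian (EuclideanSpace ℝ (Fin k))) p
      (by simp)).integrable_norm_pow hp
  have hmono : ∫ x : EuclideanSpace ℝ (Fin k),
      (3 / (2 * √k) * ‖x‖ ^ 2 - 1 / (2 * √k ^ 3) * ‖x‖ ^ 4) ∂(stdGaussian _) ≤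
      ∫ x : EuclideanSpace ℝ (Fin k), ‖x‖ ∂(stdGaussian _) := by
    refine integral_mono (((hI 2 two_ne_zero).const_mul _).sub ((hI 4 four_ne_zero).const_mul _))
      (by simpa using hI 1 one_ne_zero) fun x => ?_
    have h0 : 0 ≤ ‖x‖ := norm_nonneg x
    generalize ‖x‖ = t at *
    generalize √(k : ℝ) = s at *
    -- The quartic bound has a double root at `t = s`, hence this factorization of the difference.
    have key : 0 ≤ t * ((t - s) ^ 2 * (t + 2 * s)) / (2 * s ^ 3) := by positivity
    have : t * ((t - s) ^ 2 * (t + 2 * s)) / (2 * s ^ 3) =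
        t - (3 / (2 * s) * t ^ 2 - 1 / (2 * s ^ 3) * t ^ 4) := by
      field_simp; ring
    simp only
    linarith
  rw [integral_sub ((hI 2 two_ne_zero).const_mul _) ((hI 4 four_ne_zero).const_mul _),
    integral_const_mul, integral_const_mul, integral_norm_sq_stdGaussian,
    integral_norm_pow_four_stdGaussian] at hmono
  refine le_trans (le_of_eq ?_) hmono
  generalize √(k : ℝ) = s at *
  rw [← hss]
  field_simp
  ring

lemma integral_norm_sq_isoGaussian {k : ℕ} {v : ℝ} (hv : 0 ≤ v) :
    ∫ x, ‖x‖ ^ 2 ∂(isoGaussian k v) = v * k := by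
  rw [isoGaussian_eq_map_stdGaussian hv, integral_map (by fun_prop) (by fun_prop)]
  simp_rw [norm_smul, mul_pow]
  rw [integral_const_mul, integral_norm_sq_stdGaussian]
  simp [hv]

lemma le_integral_norm_isoGaussian {k : ℕ} (hk : 0 < k) {v : ℝ} (hv : 0 ≤ v) :
    (1 - gaussianSquareVariance / (2 * k)) * √(v * k) ≤ ∫ x, ‖x‖ ∂(isoGaussian k v) := by
  rw [isoGaussian_eq_map_stdGaussian hv, integral_map (by fun_prop) (by fun_prop)]
  simp_rw [norm_smul]
  rw [integral_const_mul, Real.sqrt_mul hv, Real.norm_of_nonneg (Real.sqrt_nonneg _)]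
  calc _ = √v * ((1 - gaussianSquareVariance / (2 * k)) * √k) := by ring
    _ ≤ _ := by gcongr; exact le_integral_norm_stdGaussian hk

lemma integral_apply_sq_isoGaussian {k : ℕ} {v : ℝ} (hv : 0 ≤ v)
    (a : EuclideanSpace ℝ (Fin k)) :
    ∫ x, ⟪a, x⟫ ^ 2 ∂(isoGaussian k v) = v * ‖a‖ ^ 2 := by
  have h := covarianceBilin_multivariateGaussian (μ := 0)
    (Matrix.PosSemidef.one.smul hv : (v • (1 : Matrix (Fin k) (Fin k) ℝ)).PosSemidef) a a
  rw [covarianceBilin_self IsGaussian.memLp_two_id] at h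
  rw [variance_of_integral_eq_zero (by fun_prop)] at h
  · simp only [isoGaussian]
    rw [h, EuclideanSpace.real_norm_sq_eq]
    simp [Matrix.smul_mulVec, dotProduct, sq, Finset.mul_sum, mul_left_comm]
  · have := IsGaussian.integral_dual (μ := multivariateGaussian 0 (v • (1 : Matrix (Fin k) (Fin k) ℝ)))
      (innerSL ℝ a)
    simpa using this

/-- A Gaussian law with an atom is a Dirac mass; mean zero would place it at the origin,
contradicting the positive second moment. -/
lemma isoGaussian_ne_zero {k : ℕ} (hk : 0 < k) {v : ℝ} (hv : 0 < v) :
    ∀ᵐ x ∂(isoGaussian k v), x ≠ 0 := by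
  have : NullSingletonClass (isoGaussian k v) := by
    refine IsGaussian.nullSingletonClass fun x hx => ?_
    have h := integral_norm_sq_isoGaussian (k := k) hv.le
    have h0 : ∫ y, y ∂(isoGaussian k v) = 0 := by simp [isoGaussian]
    rw [hx, integral_dirac] at h h0
    rw [h0] at h
    have : 0 < v * k := by positivity
    simp at h
    rcases h with h | h <;> [exact hv.ne' h; exact hk.ne' h]
  rw [ae_iff]
  simp

/-! ### The jittering risk and its minimizer -/

/-- The squared Frobenius norm. -/
noncomputable def frobSq {m k : ℕ} (M : Matrix (Fin m) (Fin k) ℝ) : ℝ := ∑ i, ∑ j, M i j ^ 2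

lemma frobSq_nonneg {m k : ℕ} (M : Matrix (Fin m) (Fin k) ℝ) : 0 ≤ frobSq M :=
  Finset.sum_nonneg fun _ _ => Finset.sum_nonneg fun _ _ => sq_nonneg _

lemma frobSq_eq_trace {m k : ℕ} (M : Matrix (Fin m) (Fin k) ℝ) :
    frobSq M = (M * M.transpose).trace := by
  simp [frobSq, Matrix.trace, Matrix.mul_apply, sq]

lemma eq_zero_of_frobSq_eq_zero {m k : ℕ} {M : Matrix (Fin m) (Fin k) ℝ} (h : frobSq M = 0) :
    M = 0 := by
  rw [frobSq_eq_trace] at h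
  have := Matrix.trace_mul_conjTranspose_self_eq_zero_iff (A := M)
  simpa [Matrix.conjTranspose_eq_transpose_of_trivial, h] using this

lemma integral_norm_sq_toEuclideanLin {m k : ℕ} {v : ℝ} (hv : 0 ≤ v)
    (M : Matrix (Fin m) (Fin k) ℝ) :
    ∫ x, ‖M.toEuclideanLin x‖ ^ 2 ∂(isoGaussian k v) = v * frobSq M := by
  have h (x : EuclideanSpace ℝ (Fin k)) : ‖M.toEuclideanLin x‖ ^ 2 =
      ∑ i, ⟪WithLp.toLp 2 (M i), x⟫ ^ 2 := by
    rw [EuclideanSpace.real_norm_sq_eq]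
    simp [Matrix.toLpLin_apply, Matrix.mulVec, dotProduct, PiLp.inner_apply, mul_comm]
  simp_rw [h]
  rw [integral_finsetSum]
  · simp_rw [integral_apply_sq_isoGaussian hv, EuclideanSpace.real_norm_sq_eq, ← Finset.mul_sum]
    rfl
  · intro i _
    have : MemLp (fun x => ⟪WithLp.toLp 2 (M i), x⟫) 2 (isoGaussian k v) :=
      (IsGaussian.memLp_two_id (μ := isoGaussian k v)).const_inner _
    exact this.integrable_sq

/-- Pythagoras in `L²`: independence and the zero mean of `g` kill the cross term. -/
lemma integral_norm_sq_add_prod {A B : Type*} [MeasurableSpace A] [MeasurableSpace B]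
    {μ : Measure A} {ν : Measure B} [IsProbabilityMeasure μ] [IsProbabilityMeasure ν]
    {F : Type*} [NormedAddCommGroup F] [InnerProductSpace ℝ F] [CompleteSpace F]
    {f : A → F} {g : B → F}
    (hf : MemLp f 2 μ) (hg : MemLp g 2 ν) (h0 : ∫ b, g b ∂ν = 0) :
    ∫ p, ‖f p.1 + g p.2‖ ^ 2 ∂(μ.prod ν) = ∫ a, ‖f a‖ ^ 2 ∂μ + ∫ b, ‖g b‖ ^ 2 ∂ν := by
  have hI : Integrable (fun p : A × B => ‖f p.1 + g p.2‖ ^ 2) (μ.prod ν) :=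
    ((hf.comp_fst ν).add (hg.comp_snd μ)).norm.integrable_sq
  rw [integral_prod _ hI]
  have h (a : A) : ∫ b, ‖f a + g b‖ ^ 2 ∂ν = ‖f a‖ ^ 2 + ∫ b, ‖g b‖ ^ 2 ∂ν := by
    simp_rw [norm_add_sq_real]
    have h1 : Integrable (fun b => 2 * ⟪f a, g b⟫) ν :=
      ((hg.integrable (by norm_num)).const_inner _).const_mul _
    have h2 : Integrable (fun b => ‖f a‖ ^ 2 + 2 * ⟪f a, g b⟫) ν := (integrable_const _).add h1
    rw [integral_add h2 hg.norm.integrable_sq, integral_add (integrable_const _) h1, integral_const_mul,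
      integral_inner (hg.integrable (by norm_num)), h0]
    simp
  simp_rw [h]
  rw [integral_add hf.norm.integrable_sq (integrable_const _)]
  simp

lemma memLp_toEuclideanLin {m k : ℕ} (v : ℝ) (M : Matrix (Fin m) (Fin k) ℝ) :
    MemLp (fun x => M.toEuclideanLin x) 2 (isoGaussian k v) :=
  (LinearMap.toContinuousLinearMap M.toEuclideanLin).comp_memLp'
    (IsGaussian.memLp_two_id (μ := isoGaussian k v))

lemma integral_toEuclideanLin {m k : ℕ} (v : ℝ) (M : Matrix (Fin m) (Fin k) ℝ) :
    ∫ x, M.toEuclideanLin x ∂(isoGaussian k v) = 0 := by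
  have := (LinearMap.toContinuousLinearMap M.toEuclideanLin).integral_comp_comm
    (IsGaussian.integrable_id (μ := isoGaussian k v))
  refine this.trans ?_
  simp [isoGaussian]

instance isProbabilityMeasure_latentNoiseLaw (d n : ℕ) (σc σz : ℝ) :
    IsProbabilityMeasure (latentNoiseLaw d n σc σz) := by
  unfold latentNoiseLaw; infer_instance

lemma jitteringRisk_linearEstimator {d n : ℕ} (U : Matrix (Fin n) (Fin d) ℝ) (σc σz σw : ℝ)
    (H : Matrix (Fin n) (Fin n) ℝ) :
    jitteringRisk U σc σz σw (linearEstimator H) =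
      ENNReal.ofReal (σc ^ 2 / d * frobSq ((H - 1) * U) +
        (σz ^ 2 / n + σw ^ 2) * frobSq H) := by
  set f : EuclideanSpace ℝ (Fin d) → EuclideanSpace ℝ (Fin n) :=
    fun c => ((H - 1) * U).toEuclideanLin c
  set g : EuclideanSpace ℝ (Fin n) → EuclideanSpace ℝ (Fin n) := fun z => H.toEuclideanLin z
  have hf := memLp_toEuclideanLin (σc ^ 2 / d) ((H - 1) * U)
  have hz := memLp_toEuclideanLin (σz ^ 2 / n) H
  have hw := memLp_toEuclideanLin (σw ^ 2) H
  have hfz : MemLp (fun p : EuclideanSpace ℝ (Fin d) × EuclideanSpace ℝ (Fin n) => f p.1 + g p.2) 2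
      (latentNoiseLaw d n σc σz) := (hf.comp_fst _).add (hz.comp_snd _)
  have e (p : (EuclideanSpace ℝ (Fin d) × EuclideanSpace ℝ (Fin n)) × EuclideanSpace ℝ (Fin n)) :
      linearEstimator H (U.toEuclideanLin p.1.1 + p.1.2 + p.2) - U.toEuclideanLin p.1.1 =
        (f p.1.1 + g p.1.2) + g p.2 := by
    simp only [linearEstimator, f, g, map_add]
    have : ((H - 1) * U).toEuclideanLin p.1.1 =
        H.toEuclideanLin (U.toEuclideanLin p.1.1) - U.toEuclideanLin p.1.1 := by
      simp [Matrix.toLpLin_apply, Matrix.sub_mul]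
    rw [this]; abel
  have hI : Integrable (fun p : (EuclideanSpace ℝ (Fin d) × EuclideanSpace ℝ (Fin n)) ×
      EuclideanSpace ℝ (Fin n) => ‖f p.1.1 + g p.1.2 + g p.2‖ ^ 2)
      ((latentNoiseLaw d n σc σz).prod (isoGaussian n (σw ^ 2))) := ((hfz.comp_fst (isoGaussian n (σw ^ 2))).add
    (hw.comp_snd (latentNoiseLaw d n σc σz))).norm.integrable_sq
  unfold jitteringRisk
  simp_rw [e]
  have e2 (p : (EuclideanSpace ℝ (Fin d) × EuclideanSpace ℝ (Fin n)) ×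
      EuclideanSpace ℝ (Fin n)) : ‖f p.1.1 + g p.1.2 + g p.2‖ₑ ^ 2 =
      ENNReal.ofReal (‖f p.1.1 + g p.1.2 + g p.2‖ ^ 2) := by
    rw [ENNReal.ofReal_pow (norm_nonneg _), ofReal_norm]
  simp_rw [e2]
  rw [← ofReal_integral_eq_lintegral_ofReal hI (ae_of_all _ fun _ => sq_nonneg _)]
  congr 1
  refine (integral_norm_sq_add_prod hfz hw (integral_toEuclideanLin _ _)).trans ?_
  rw [latentNoiseLaw, integral_norm_sq_add_prod hf hz (integral_toEuclideanLin _ _),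
    integral_norm_sq_toEuclideanLin (by positivity), integral_norm_sq_toEuclideanLin (by positivity),
    integral_norm_sq_toEuclideanLin (by positivity)]
  ring

/-- With `E = H - a U Uᵀ`, both cross terms are multiples of `tr(E U Uᵀ)`, with total coefficient
`2(κ(a - 1) + l a)`, which `ha` makes zero. -/
lemma frobSq_completing_square {d n : ℕ} {U : Matrix (Fin n) (Fin d) ℝ} (hU : U.transpose * U = 1)
    {κ l a : ℝ} (ha : κ * (1 - a) = l * a) (H : Matrix (Fin n) (Fin n) ℝ) :
    κ * frobSq ((H - 1) * U) + l * frobSq H =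
      κ * frobSq ((a • (U * U.transpose) - 1) * U) + l * frobSq (a • (U * U.transpose)) +
      (κ * frobSq ((H - a • (U * U.transpose)) * U) +
        l * frobSq (H - a • (U * U.transpose))) := by
  set E := H - a • (U * U.transpose) with hE
  have hH : H = a • (U * U.transpose) + E := by rw [hE]; abel
  have h1 : (H - 1) * U = (a - 1) • U + E * U := by
    rw [hH]
    simp only [add_sub_right_comm, Matrix.add_mul, Matrix.sub_mul, Matrix.smul_mul, Matrix.mul_assoc, hU,
      Matrix.mul_one, Matrix.one_mul, sub_smul, one_smul]
  have h2 : (a • (U * U.transpose) - 1) * U = (a - 1) • U := by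
    simp only [Matrix.sub_mul, Matrix.smul_mul, Matrix.mul_assoc, hU,
      Matrix.mul_one, Matrix.one_mul, sub_smul, one_smul]
  rw [h1, h2, hH]
  have exp {m k : ℕ} (A B : Matrix (Fin m) (Fin k) ℝ) :
      frobSq (A + B) = frobSq A + frobSq B + 2 * (B * A.transpose).trace := by
    have : (A * B.transpose).trace = (B * A.transpose).trace := by
      rw [← Matrix.trace_transpose, Matrix.transpose_mul, Matrix.transpose_transpose]
    simp only [frobSq_eq_trace, Matrix.transpose_add, Matrix.add_mul, Matrix.mul_add, Matrix.trace_add, this]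
    ring
  rw [exp, exp]
  simp only [Matrix.transpose_smul, Matrix.transpose_mul, Matrix.transpose_transpose,
    Matrix.mul_smul, Matrix.trace_smul, Matrix.mul_assoc, smul_eq_mul]
  linear_combination (-2 * (E * (U * U.transpose)).trace) * ha

lemma jitterShrinkage_stationary {d n : ℕ} (hd : 0 < d) {σc : ℝ} (σz σw : ℝ) (hc : 0 < σc) :
    σc ^ 2 / d * (1 - jitterShrinkage d n σc σz σw) =
      (σz ^ 2 / n + σw ^ 2) * jitterShrinkage d n σc σz σw := by
  have hd' : (0 : ℝ) < d := by exact_mod_cast hd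
  have hD : (0 : ℝ) < σc ^ 2 + σz ^ 2 * (d / n) + σw ^ 2 * d := by positivity
  unfold jitterShrinkage
  rw [div_mul_eq_mul_div, div_eq_iff hd'.ne', mul_assoc]
  field_simp
  ring

lemma isSymm_smul_mul_transpose {d n : ℕ} (a : ℝ) (U : Matrix (Fin n) (Fin d) ℝ) :
    (a • (U * U.transpose)).IsSymm := by
  simp [Matrix.IsSymm]

lemma isJitteringMinimizer_shrinkage {d n : ℕ} (hd : 0 < d) {U : Matrix (Fin n) (Fin d) ℝ}
    (hU : U.transpose * U = 1) {σc : ℝ} (hc : 0 < σc) (σz σw : ℝ) :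
    IsJitteringMinimizer U σc σz σw (jitterShrinkage d n σc σz σw • (U * U.transpose)) := by
  refine ⟨isSymm_smul_mul_transpose _ _, fun H _ => ?_⟩
  simp only [Set.mem_ofPred_eq, jitteringRisk_linearEstimator]
  apply ENNReal.ofReal_le_ofReal
  rw [frobSq_completing_square hU (jitterShrinkage_stationary hd σz σw hc) H]
  have := frobSq_nonneg (H - jitterShrinkage d n σc σz σw • (U * U.transpose))
  have := frobSq_nonneg ((H - jitterShrinkage d n σc σz σw • (U * U.transpose)) * U)
  have : 0 ≤ σc ^ 2 / d * frobSq ((H - jitterShrinkage d n σc σz σw • (U * U.transpose)) * U) +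
    (σz ^ 2 / n + σw ^ 2) * frobSq (H - jitterShrinkage d n σc σz σw • (U * U.transpose)) := by
    positivity
  linarith

/-- The excess risk contains the full `frobSq (H - Hj)` with weight `σz² / n + σw²`, positive since
`σz > 0`. The other square sees `H - Hj` only on the range of `U`. -/
lemma IsJitteringMinimizer.eq_shrinkage {d n : ℕ} (hd : 0 < d) (hn : 0 < n)
    {U : Matrix (Fin n) (Fin d) ℝ}
    (hU : U.transpose * U = 1) {σc σz σw : ℝ} (hc : 0 < σc) (hz : 0 < σz)
    {H : Matrix (Fin n) (Fin n) ℝ} (hH : IsJitteringMinimizer U σc σz σw H) :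
    H = jitterShrinkage d n σc σz σw • (U * U.transpose) := by
  set Hj := jitterShrinkage d n σc σz σw • (U * U.transpose) with hHj
  have h := hH.2 (isSymm_smul_mul_transpose (jitterShrinkage d n σc σz σw) U)
  have p1 := frobSq_nonneg ((H - Hj) * U)
  have p2 := frobSq_nonneg (H - Hj)
  have q1 := frobSq_nonneg ((Hj - 1) * U)
  have q2 := frobSq_nonneg Hj
  have hl : 0 < σz ^ 2 / n + σw ^ 2 := by positivity
  simp only [Set.mem_ofPred_eq, jitteringRisk_linearEstimator, ← hHj] at h
  rw [ENNReal.ofReal_le_ofReal_iff (by positivity),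
    frobSq_completing_square hU (jitterShrinkage_stationary hd σz σw hc) H, ← hHj] at h
  have h1 : 0 ≤ σc ^ 2 / d * frobSq ((H - Hj) * U) := by positivity
  have h2 : (σz ^ 2 / n + σw ^ 2) * frobSq (H - Hj) ≤ 0 := by linarith
  have h3 : frobSq (H - Hj) = 0 := le_antisymm (nonpos_of_mul_nonpos_right h2 hl) p2
  exact sub_eq_zero.1 (eq_zero_of_frobSq_eq_zero h3)

lemma jitterShrinkage_eq_robustShrinkage {d n : ℕ} (hd : 0 < d) {σc σz ε : ℝ} (hc : 0 < σc)
    (hz : 0 ≤ σz) (hε : 0 ≤ ε) (h : ε ^ 2 < σc ^ 2) :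
    jitterShrinkage d n σc σz (jitterLevel d n σc σz ε) = robustShrinkage d n σc σz ε := by
  have hd' : (0 : ℝ) < d := by exact_mod_cast hd
  have hg : 0 < σc ^ 2 - ε ^ 2 := by linarith
  unfold jitterShrinkage robustShrinkage jitterLevel
  rw [Real.sq_sqrt (by positivity)]
  have hr : √((d : ℝ) / n) ^ 2 = d / n := Real.sq_sqrt (by positivity)
  rw [show σc ^ 2 - ε ^ 2 + σz ^ 2 * ((d : ℝ) / n) = σc ^ 2 + σz ^ 2 * (d / n) - ε ^ 2 by ring]
  have hS2 : √(σc ^ 2 + σz ^ 2 * ((d : ℝ) / n) - ε ^ 2) ^ 2 =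
    σc ^ 2 + σz ^ 2 * (d / n) - ε ^ 2 := Real.sq_sqrt (by
      have : 0 ≤ σz ^ 2 * ((d : ℝ) / n) := by positivity
      linarith)
  have hS : 0 < √(σc ^ 2 + σz ^ 2 * ((d : ℝ) / n) - ε ^ 2) := Real.sqrt_pos.2 (by
      have : 0 ≤ σz ^ 2 * ((d : ℝ) / n) := by positivity
      linarith)
  have hr0 : 0 ≤ √((d : ℝ) / n) := Real.sqrt_nonneg _
  generalize √((d : ℝ) / n) = r at *
  rw [← hr] at hS2 hS ⊢
  generalize √(σc ^ 2 + σz ^ 2 * r ^ 2 - ε ^ 2) = S at *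
  -- The relation `S² + ε² = σc² + σz² r²` makes the denominator of the jittering factor split into
  -- a product.
  have hA : σc ^ 2 + σz ^ 2 * r ^ 2 + (ε ^ 2 * σz ^ 2 * r ^ 2 + σz * r * σc * ε * S) /
      (d * (σc ^ 2 - ε ^ 2)) * d = σc * S * (σc * S + σz * r * ε) / (σc ^ 2 - ε ^ 2) := by
    field_simp
    linear_combination (-σc ^ 2) * hS2
  rw [hA]
  have : 0 < σc * S + σz * r * ε := by positivity
  have h3 : 0 < σc ^ 2 + σz ^ 2 * r ^ 2 := by positivity
  rw [div_div_eq_mul_div, div_eq_div_iff (by positivity) h3.ne']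
  field_simp
  linear_combination (-σc ^ 2) * hS2

/-! ### Second moment of a shifted Gaussian norm -/

/-- Needed for an integrand of varying sign, as in the linearized lower bound for the risk. -/
lemma ofReal_integral_le_lintegral_ofReal {Ω : Type*} [MeasurableSpace Ω] {μ : Measure Ω}
    {f : Ω → ℝ} (hf : Integrable f μ) :
    ENNReal.ofReal (∫ x, f x ∂μ) ≤ ∫⁻ x, ENNReal.ofReal (f x) ∂μ := by
  rw [integral_eq_lintegral_pos_part_sub_lintegral_neg_part hf]
  exact (ENNReal.ofReal_le_ofReal (sub_le_self _ ENNReal.toReal_nonneg)).trans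
    ENNReal.ofReal_toReal_le

lemma integral_norm_add_const_sq_isoGaussian {k : ℕ} {v : ℝ} (hv : 0 ≤ v) (t : ℝ) :
    ∫ x, (‖x‖ + t) ^ 2 ∂(isoGaussian k v) =
      v * k + 2 * t * ∫ x, ‖x‖ ∂(isoGaussian k v) + t ^ 2 := by
  have h2 : Integrable (fun x => ‖x‖ ^ 2) (isoGaussian k v) :=
    (IsGaussian.memLp_two_id (μ := isoGaussian k v)).norm.integrable_sq
  have h1 : Integrable (fun x => ‖x‖) (isoGaussian k v) :=
    (IsGaussian.integrable_id (μ := isoGaussian k v)).norm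
  have e (x : EuclideanSpace ℝ (Fin k)) : (‖x‖ + t) ^ 2 = ‖x‖ ^ 2 + 2 * t * ‖x‖ + t ^ 2 := by ring
  simp_rw [e]
  have h3 : Integrable (fun x => ‖x‖ ^ 2 + 2 * t * ‖x‖) (isoGaussian k v) :=
    h2.add (h1.const_mul _)
  rw [integral_add h3 (integrable_const _), integral_add h2 (h1.const_mul _),
    integral_const_mul, integral_norm_sq_isoGaussian hv]
  simp

lemma integral_norm_isoGaussian_le {k : ℕ} {v : ℝ} (hv : 0 ≤ v) :
    ∫ x, ‖x‖ ∂(isoGaussian k v) ≤ √(v * k) := by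
  apply Real.le_sqrt_of_sq_le
  have h : MemLp (fun x => ‖x‖) 2 (isoGaussian k v) :=
    (IsGaussian.memLp_two_id (μ := isoGaussian k v)).norm
  have h0 := variance_nonneg (fun x => ‖x‖) (isoGaussian k v)
  rw [variance_eq_sub h] at h0
  have := integral_norm_sq_isoGaussian (k := k) hv
  simp only [Pi.pow_apply] at h0
  linarith

lemma integral_norm_add_const_sq_isoGaussian_le {k : ℕ} {v : ℝ} (hv : 0 ≤ v) {t : ℝ}
    (ht : 0 ≤ t) : ∫ x, (‖x‖ + t) ^ 2 ∂(isoGaussian k v) ≤ (√(v * k) + t) ^ 2 := by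
  rw [integral_norm_add_const_sq_isoGaussian hv, add_sq, Real.sq_sqrt (by positivity)]
  have := mul_le_mul_of_nonneg_left (integral_norm_isoGaussian_le (k := k) hv) ht
  linarith

lemma le_integral_norm_add_const_sq_isoGaussian {k : ℕ} (hk : 0 < k) {v : ℝ} (hv : 0 ≤ v) {t : ℝ}
    (ht : 0 ≤ t) :
    (1 - gaussianSquareVariance / (2 * k)) * (√(v * k) + t) ^ 2 ≤
      ∫ x, (‖x‖ + t) ^ 2 ∂(isoGaussian k v) := by
  rw [integral_norm_add_const_sq_isoGaussian hv, add_sq, Real.sq_sqrt (by positivity)]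
  have := mul_le_mul_of_nonneg_left (le_integral_norm_isoGaussian hk hv) ht
  have hK : 0 ≤ gaussianSquareVariance / (2 * k) :=
    div_nonneg gaussianSquareVariance_nonneg (by positivity)
  generalize gaussianSquareVariance / (2 * (k : ℝ)) = η at *
  have h1 : 0 ≤ η * (v * k) := by positivity
  have h2 : 0 ≤ η * t ^ 2 := by positivity
  linarith

/-! ### Rotation invariance and Schur averaging -/

lemma integral_comp_prodMap_linearIsometryEquiv {k : ℕ}
    {ν : Measure (EuclideanSpace ℝ (Fin k) × EuclideanSpace ℝ (Fin k))}
    (hν : ∀ Q : EuclideanSpace ℝ (Fin k) ≃ₗᵢ[ℝ] EuclideanSpace ℝ (Fin k),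
      MeasurePreserving (Prod.map Q Q) ν ν)
    (Q : EuclideanSpace ℝ (Fin k) ≃ₗᵢ[ℝ] EuclideanSpace ℝ (Fin k))
    (f : EuclideanSpace ℝ (Fin k) × EuclideanSpace ℝ (Fin k) → ℝ) :
    ∫ p, f (Prod.map Q Q p) ∂ν = ∫ p, f p ∂ν :=
  (hν Q).integral_comp (Q.toHomeomorph.prodCongr Q.toHomeomorph).measurableEmbedding f

/-- Schur's lemma for the cross-covariance of two equivariant fields under a rotation-invariant
law: it is a multiple of the identity. -/
lemma integral_inner_toEuclideanLin_of_equivariant {k : ℕ}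
    {ν : Measure (EuclideanSpace ℝ (Fin k) × EuclideanSpace ℝ (Fin k))}
    (hν : ∀ Q : EuclideanSpace ℝ (Fin k) ≃ₗᵢ[ℝ] EuclideanSpace ℝ (Fin k),
      MeasurePreserving (Prod.map Q Q) ν ν)
    {F G : EuclideanSpace ℝ (Fin k) × EuclideanSpace ℝ (Fin k) → EuclideanSpace ℝ (Fin k)}
    (hF : MemLp F 2 ν) (hG : MemLp G 2 ν)
    (hFQ : ∀ (Q : EuclideanSpace ℝ (Fin k) ≃ₗᵢ[ℝ] EuclideanSpace ℝ (Fin k)) p,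
      F (Prod.map Q Q p) = Q (F p))
    (hGQ : ∀ (Q : EuclideanSpace ℝ (Fin k) ≃ₗᵢ[ℝ] EuclideanSpace ℝ (Fin k)) p,
      G (Prod.map Q Q p) = Q (G p))
    (A : Matrix (Fin k) (Fin k) ℝ) :
    k * ∫ p, ⟪F p, A.toEuclideanLin (G p)⟫ ∂ν = A.trace * ∫ p, ⟪F p, G p⟫ ∂ν := by
  have hint (i j) : Integrable (fun p => F p i * G p j) ν :=
    MemLp.integrable_mul (p := 2) (q := 2)
      ((EuclideanSpace.proj i : EuclideanSpace ℝ (Fin k) →L[ℝ] ℝ).comp_memLp' hF)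
      ((EuclideanSpace.proj j : EuclideanSpace ℝ (Fin k) →L[ℝ] ℝ).comp_memLp' hG)
  have hoff (i j) (hij : i ≠ j) : ∫ p, F p i * G p j ∂ν = 0 := by
    -- Flipping the sign of coordinate `i` alone negates the off-diagonal moment.
    let Q : EuclideanSpace ℝ (Fin k) ≃ₗᵢ[ℝ] EuclideanSpace ℝ (Fin k) :=
      LinearIsometryEquiv.piLpCongrRight 2
        fun l => if l = i then LinearIsometryEquiv.neg ℝ else LinearIsometryEquiv.refl ℝ ℝ
    have h := integral_comp_prodMap_linearIsometryEquiv hν Q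
      (fun p => F p i * G p j)
    simp_rw [hFQ, hGQ] at h
    have hi (x) : (Q x) i = - x i := by simp [Q]
    have hj (x) : (Q x) j = x j := by simp [Q, hij.symm]
    simp_rw [hi, hj, neg_mul, integral_neg] at h
    linarith
  have hdiag (i j) : ∫ p, F p i * G p i ∂ν = ∫ p, F p j * G p j ∂ν := by
    -- Swapping two coordinates equates the diagonal moments.
    let Q : EuclideanSpace ℝ (Fin k) ≃ₗᵢ[ℝ] EuclideanSpace ℝ (Fin k) :=
      LinearIsometryEquiv.piLpCongrLeft 2 ℝ ℝ (Equiv.swap i j)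
    have h := integral_comp_prodMap_linearIsometryEquiv hν Q
      (fun p => F p i * G p i)
    simp_rw [hFQ, hGQ] at h
    have hi (x) : (Q x) i = x j := by
      simp [Q, LinearIsometryEquiv.piLpCongrLeft_apply, Equiv.piCongrLeft']
    simp_rw [hi] at h
    exact h.symm
  have hinner : ∫ p, ⟪F p, G p⟫ ∂ν = ∑ j, ∫ p, F p j * G p j ∂ν := by
    rw [← integral_finsetSum _ fun i _ => hint i i]
    simp [PiLp.inner_apply, mul_comm]
  have hA : ∫ p, ⟪F p, A.toEuclideanLin (G p)⟫ ∂ν = ∑ i, A i i * ∫ p, F p i * G p i ∂ν := by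
    have e (p) : ⟪F p, A.toEuclideanLin (G p)⟫ = ∑ i, ∑ j, A i j * (F p i * G p j) := by
      simp only [PiLp.inner_apply, Matrix.toLpLin_apply, Matrix.mulVec, dotProduct,
        RCLike.inner_apply, conj_trivial, Finset.sum_mul]
      exact Finset.sum_congr rfl fun i _ => Finset.sum_congr rfl fun j _ => by ring
    rw [funext e]
    have hA2 (i j) : Integrable (fun p => A i j * (F p i * G p j)) ν := (hint i j).const_mul _
    rw [integral_finsetSum _ fun i _ => integrable_finsetSum _ fun j _ => hA2 i j]
    refine Finset.sum_congr rfl fun i _ => ?_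
    rw [integral_finsetSum _ fun j _ => hA2 i j]
    simp_rw [integral_const_mul]
    refine Finset.sum_eq_single_of_mem i (Finset.mem_univ i) fun j _ hji => ?_
    rw [hoff i j hji.symm, mul_zero]
  rw [hA, hinner, Matrix.trace, Finset.mul_sum, Finset.sum_mul]
  refine Finset.sum_congr rfl fun i _ => ?_
  simp_rw [fun j => hdiag j i]
  simp [Matrix.diag]
  ring

lemma measurePreserving_prodMap_isoGaussian {k : ℕ} {v w : ℝ} (hv : 0 ≤ v) (hw : 0 ≤ w)
    (Q : EuclideanSpace ℝ (Fin k) ≃ₗᵢ[ℝ] EuclideanSpace ℝ (Fin k)) :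
    MeasurePreserving (Prod.map Q Q) ((isoGaussian k v).prod (isoGaussian k w))
      ((isoGaussian k v).prod (isoGaussian k w)) := by
  have h {s : ℝ} (hs : 0 ≤ s) : MeasurePreserving Q (isoGaussian k s) (isoGaussian k s) := by
    refine ⟨Q.continuous.measurable, ?_⟩
    refine isoGaussian_map_of_norm_adjoint hs (Q.toContinuousLinearEquiv :
      EuclideanSpace ℝ (Fin k) →L[ℝ] EuclideanSpace ℝ (Fin k)) fun t => ?_
    rw [LinearIsometryEquiv.adjoint_eq_symm]
    exact Q.symm.norm_map t
  exact (h hv).prod (h hw)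

/-! ### The equivariant attack on a shrinkage estimator -/

/-- The linear residual `(α - 1) c + α b` of the shrinkage estimator. -/
noncomputable def shrinkResidual {k : ℕ} (α : ℝ)
    (p : EuclideanSpace ℝ (Fin k) × EuclideanSpace ℝ (Fin k)) : EuclideanSpace ℝ (Fin k) :=
  (α - 1) • p.1 + α • p.2

open Classical in
/-- The worst-case perturbation of the shrinkage estimator: it has norm at most `ε` and points along
the residual, or along the code where the residual vanishes. -/
noncomputable def shrinkAttack {k : ℕ} (α t : ℝ)
    (p : EuclideanSpace ℝ (Fin k) × EuclideanSpace ℝ (Fin k)) : EuclideanSpace ℝ (Fin k) :=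
  (t / ‖if shrinkResidual α p = 0 then p.1 else shrinkResidual α p‖) •
    (if shrinkResidual α p = 0 then p.1 else shrinkResidual α p)

section Attack

variable {k : ℕ} (α t : ℝ)

lemma shrinkResidual_equivariant (Q : EuclideanSpace ℝ (Fin k) ≃ₗᵢ[ℝ] EuclideanSpace ℝ (Fin k)) (p) :
    shrinkResidual α (Prod.map Q Q p) = Q (shrinkResidual α p) := by
  simp [shrinkResidual]

/-- The fallback direction is `p.1`, not a fixed vector, so that equivariance holds even where the
residual vanishes. -/
lemma shrinkAttack_equivariant (Q : EuclideanSpace ℝ (Fin k) ≃ₗᵢ[ℝ] EuclideanSpace ℝ (Fin k)) (p) :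
    shrinkAttack α t (Prod.map Q Q p) = Q (shrinkAttack α t p) := by
  unfold shrinkAttack
  rw [shrinkResidual_equivariant]
  by_cases h : shrinkResidual α p = 0 <;> simp [h]

lemma measurable_shrinkResidual : Measurable (shrinkResidual (k := k) α) := by
  unfold shrinkResidual; fun_prop

lemma measurable_shrinkAttack : Measurable (shrinkAttack (k := k) α t) := by
  have h := measurable_shrinkResidual (k := k) α
  have : Measurable fun p => if shrinkResidual α p = 0 then p.1 else shrinkResidual (k := k) α p :=
    Measurable.ite (h (measurableSet_singleton 0)) measurable_fst h
  exact ((measurable_const.div this.norm).smul this)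

lemma norm_shrinkAttack_le (p : EuclideanSpace ℝ (Fin k) × EuclideanSpace ℝ (Fin k)) :
    ‖shrinkAttack α t p‖ ≤ |t| := by
  unfold shrinkAttack
  generalize (if shrinkResidual α p = 0 then p.1 else shrinkResidual α p) = u
  rw [norm_smul, norm_div, norm_norm, Real.norm_eq_abs]
  rcases eq_or_ne ‖u‖ 0 with h | h
  · simp [h]
  · rw [div_mul_cancel₀ _ h]

-- The attack is collinear with the residual, so the triangle inequality is an equality. Only the
-- sign of `α * t` matters, which allows negative `α`.
variable {α t} in
lemma norm_shrinkResidual_add_attack (hα : 0 ≤ α * t)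
    {p : EuclideanSpace ℝ (Fin k) × EuclideanSpace ℝ (Fin k)} (hp : p.1 ≠ 0) :
    ‖shrinkResidual α p + α • shrinkAttack α t p‖ = ‖shrinkResidual α p‖ + α * t := by
  unfold shrinkAttack
  by_cases h : shrinkResidual α p = 0
  · rw [h]
    simp only [if_true, zero_add, norm_zero, smul_smul, norm_smul]
    have : ‖p.1‖ ≠ 0 := norm_ne_zero_iff.2 hp
    rw [← mul_div_assoc, norm_div, norm_norm, Real.norm_of_nonneg hα, div_mul_cancel₀ _ this]
  · simp only [h, if_false]
    have h0 : 0 < ‖shrinkResidual α p‖ := norm_pos_iff.2 h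
    rw [smul_smul, ← mul_div_assoc]
    nth_rw 1 [← one_smul ℝ (shrinkResidual α p)]
    rw [← add_smul, norm_smul, Real.norm_of_nonneg (by positivity), add_mul, one_mul,
      div_mul_cancel₀ _ h0.ne']

end Attack

/-! ### The optimal shrinkage factor -/

lemma integrable_inner_of_memLp_two {Ω E : Type*} [MeasurableSpace Ω] {μ : Measure Ω}
    [NormedAddCommGroup E] [InnerProductSpace ℝ E] {f g : Ω → E} (hf : MemLp f 2 μ)
    (hg : MemLp g 2 μ) : Integrable (fun x => ⟪f x, g x⟫) μ := by
  refine (hf.norm.integrable_mul hg.norm).mono' (hf.1.inner hg.1) (ae_of_all _ fun x => ?_)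
  exact norm_inner_le_norm _ _

/-- The root mean squared error of the shrinkage estimator `α U Uᵀ` without perturbation. -/
noncomputable def shrinkError (d n : ℕ) (σc σz α : ℝ) : ℝ :=
  √((α - 1) ^ 2 * σc ^ 2 + α ^ 2 * (σz ^ 2 * (d / n)))

/-- Write `τ = σz √(d/n)`. For a unit vector `(x, y)` with `σc x - τ y = ε`, Cauchy–Schwarz gives
`shrinkError ≥ x(1 - α)σc + yατ = σc x - αε`. Adding `|α|ε ≥ αε` leaves the bound `σc x`, free of
`α` and attained at the robust factor. -/
lemma robustShrinkage_optimal {d n : ℕ} {σc σz ε : ℝ} (hc : 0 < σc)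
    (hz : 0 ≤ σz) (hε : 0 ≤ ε) (h : ε ^ 2 < σc ^ 2) :
    0 ≤ robustShrinkage d n σc σz ε ∧ ∀ α,
      shrinkError d n σc σz (robustShrinkage d n σc σz ε) + robustShrinkage d n σc σz ε * ε ≤
        shrinkError d n σc σz α + |α| * ε := by
  have hr : √((d : ℝ) / n) ^ 2 = d / n := Real.sq_sqrt (by positivity)
  have hr0 : 0 ≤ √((d : ℝ) / n) := Real.sqrt_nonneg _
  unfold robustShrinkage shrinkError
  rw [← hr]
  generalize √((d : ℝ) / n) = r at *
  rw [Real.sqrt_sq hr0, show σz ^ 2 * r ^ 2 = (σz * r) ^ 2 by ring, show ε * σc * σz * r = ε * σc * (σz * r) by ring]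
  have ht : 0 ≤ σz * r := by positivity
  generalize σz * r = τ at *
  have hpos : 0 < σc ^ 2 + τ ^ 2 - ε ^ 2 := by nlinarith [sq_nonneg τ]
  have hS2 := Real.sq_sqrt hpos.le
  have hS := Real.sqrt_pos.2 hpos
  generalize √(σc ^ 2 + τ ^ 2 - ε ^ 2) = S at *
  have hN : 0 < σc ^ 2 + τ ^ 2 := by positivity
  -- The point `(x, y)` is an intersection of the unit circle with the line `σc x - τ y = ε`; the
  -- one chosen has `y ≥ 0`, whence a nonnegative shrinkage factor.
  obtain ⟨x, hx⟩ : ∃ x, x = (σc * ε + τ * S) / (σc ^ 2 + τ ^ 2) := ⟨_, rfl⟩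
  obtain ⟨y, hy⟩ : ∃ y, y = (σc * S - ε * τ) / (σc ^ 2 + τ ^ 2) := ⟨_, rfl⟩
  have hxy : x ^ 2 + y ^ 2 = 1 := by
    rw [hx, hy, div_pow, div_pow, ← add_div, div_eq_one_iff_eq (by positivity)]
    linear_combination (σc ^ 2 + τ ^ 2) * hS2
  have hlin : σc * x - τ * y = ε := by
    rw [hx, hy]; field_simp; ring
  have hεc : ε ≤ σc := by nlinarith
  have hετ : ε * τ ≤ σc * S := by
    refine abs_le_of_sq_le_sq' ?_ (by positivity) |>.2
    nlinarith [sq_nonneg τ, sq_nonneg σc]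
  have hy0 : 0 ≤ y := by rw [hy]; exact div_nonneg (by linarith) hN.le
  have ha : (σc ^ 2 - ε * σc * τ / S) / (σc ^ 2 + τ ^ 2) = σc * y / S := by
    rw [hy]; field_simp
  have h1a : σc * y / S - 1 = - (τ * x / S) := by
    rw [hx, hy]; field_simp; ring
  rw [ha]
  have hs : √((σc * y / S - 1) ^ 2 * σc ^ 2 + (σc * y / S) ^ 2 * τ ^ 2) = τ * σc / S := by
    rw [h1a, Real.sqrt_eq_iff_mul_self_eq (by positivity) (by positivity)]
    field_simp
    linear_combination τ ^ 2 * hxy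
  refine ⟨by positivity, fun α => ?_⟩
  rw [hs]
  have hval : τ * σc / S + σc * y / S * ε = σc * x := by
    rw [hx, hy]; field_simp; linear_combination (-τ) * hS2
  rw [hval]
  have hcs : x * ((1 - α) * σc) + y * (α * τ) ≤ √((α - 1) ^ 2 * σc ^ 2 + α ^ 2 * τ ^ 2) := by
    apply Real.le_sqrt_of_sq_le
    have : (α - 1) ^ 2 * σc ^ 2 + α ^ 2 * τ ^ 2 - (x * ((1 - α) * σc) + y * (α * τ)) ^ 2 =
      (x * (α * τ) - y * ((1 - α) * σc)) ^ 2 := by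
      linear_combination (-((1 - α) ^ 2 * σc ^ 2 + α ^ 2 * τ ^ 2)) * hxy
    nlinarith [sq_nonneg (x * (α * τ) - y * ((1 - α) * σc))]
  have h2 : α * ε ≤ |α| * ε := mul_le_mul_of_nonneg_right (le_abs_self α) hε
  have h3 : σc * x = x * ((1 - α) * σc) + y * (α * τ) + α * ε := by
    linear_combination α * hlin
  linarith

/-! ### Upper and lower bounds for the worst-case risk -/

section Isometry

variable {d n : ℕ} {W : EuclideanSpace ℝ (Fin d) →L[ℝ] EuclideanSpace ℝ (Fin n)}

lemma norm_map_of_adjoint_comp (hW : ∀ c, W.adjoint (W c) = c) (c) : ‖W c‖ = ‖c‖ := by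
  have : ‖W c‖ ^ 2 = ‖c‖ ^ 2 := by
    rw [← real_inner_self_eq_norm_sq, ← ContinuousLinearMap.adjoint_inner_right, hW,
      real_inner_self_eq_norm_sq]
  exact (sq_eq_sq₀ (norm_nonneg _) (norm_nonneg _)).1 this

lemma norm_adjoint_le_of_adjoint_comp (hW : ∀ c, W.adjoint (W c) = c) (e) :
    ‖W.adjoint e‖ ≤ ‖e‖ := by
  have h : ‖W.adjoint e‖ ^ 2 ≤ ‖W.adjoint e‖ * ‖e‖ := by
    rw [← real_inner_self_eq_norm_sq, ContinuousLinearMap.adjoint_inner_right]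
    exact (real_inner_le_norm _ _).trans_eq (by rw [norm_map_of_adjoint_comp hW])
  by_contra! hlt
  nlinarith [norm_nonneg e]

lemma measurePreserving_latentNoiseLaw (hW : ∀ c, W.adjoint (W c) = c) (σc σz : ℝ) :
    MeasurePreserving (Prod.map id W.adjoint) (latentNoiseLaw d n σc σz)
      ((isoGaussian d (σc ^ 2 / d)).prod (isoGaussian d (σz ^ 2 / n))) := by
  refine (MeasurePreserving.id _).prod ⟨by fun_prop, ?_⟩
  refine isoGaussian_map_of_norm_adjoint (by positivity) _ fun t => ?_
  rw [ContinuousLinearMap.adjoint_adjoint, norm_map_of_adjoint_comp hW]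

/-- This reflection fixes the range of `W` and negates its orthogonal complement. It is a
self-adjoint involution, hence norm-preserving; it serves to average out the noise outside the
signal space. -/
lemma measurePreserving_latentNoiseLaw_reflection (hW : ∀ c, W.adjoint (W c) = c) (σc σz : ℝ) :
    MeasurePreserving (Prod.map id fun z => (2 : ℝ) • W (W.adjoint z) - z)
      (latentNoiseLaw d n σc σz) (latentNoiseLaw d n σc σz) := by
  refine (MeasurePreserving.id _).prod ⟨by fun_prop, ?_⟩
  set L : EuclideanSpace ℝ (Fin n) →L[ℝ] EuclideanSpace ℝ (Fin n) :=
    (2 : ℝ) • W ∘L W.adjoint - ContinuousLinearMap.id ℝ _ with hL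
  have hadj : L.adjoint = L := by
    rw [hL, map_sub, map_smulₛₗ, ContinuousLinearMap.adjoint_comp,
      ContinuousLinearMap.adjoint_adjoint, ContinuousLinearMap.adjoint_id]
    simp
  refine isoGaussian_map_of_norm_adjoint (L := L) (by positivity) fun t => ?_
  have : ‖L.adjoint t‖ ^ 2 = ‖t‖ ^ 2 := by
    rw [hadj, ← real_inner_self_eq_norm_sq, ← ContinuousLinearMap.adjoint_inner_right, hadj]
    have : L (L t) = t := by
      simp only [hL, sub_apply, smul_apply,
        ContinuousLinearMap.comp_apply, ContinuousLinearMap.id_apply, map_sub, map_smul, hW]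
      module
    rw [this, real_inner_self_eq_norm_sq]
  exact (sq_eq_sq₀ (norm_nonneg _) (norm_nonneg _)).1 this

lemma map_shrinkResidual (d n : ℕ) (σc σz α : ℝ) :
    ((isoGaussian d (σc ^ 2 / d)).prod (isoGaussian d (σz ^ 2 / n))).map (shrinkResidual α) =
      isoGaussian d ((α - 1) ^ 2 * (σc ^ 2 / d) + α ^ 2 * (σz ^ 2 / n)) :=
  isoGaussian_prod_map_add (by positivity) (by positivity) _ _

lemma shrinkError_eq (hd : 0 < d) (n : ℕ) (σc σz α : ℝ) :
    shrinkError d n σc σz α =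
      √(((α - 1) ^ 2 * (σc ^ 2 / d) + α ^ 2 * (σz ^ 2 / n)) * d) := by
  have hd' : (d : ℝ) ≠ 0 := by exact_mod_cast hd.ne'
  unfold shrinkError
  congr 1
  field_simp

/-- `W` is isometric and its adjoint a contraction, so the attacked error is at most the residual
norm plus `a * ε`. Then `E‖x‖ ≤ √(E‖x‖²)`. -/
lemma lintegral_shrinkage_le (hW : ∀ c, W.adjoint (W c) = c) (hd : 0 < d) (σc σz : ℝ)
    {ε a : ℝ} (hε : 0 ≤ ε) (ha : 0 ≤ a) :
    ∫⁻ p, ⨆ e ∈ Metric.closedBall (0 : EuclideanSpace ℝ (Fin n)) ε,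
      ‖a • W (W.adjoint (W p.1 + p.2 + e)) - W p.1‖ₑ ^ 2 ∂(latentNoiseLaw d n σc σz) ≤
      ENNReal.ofReal ((shrinkError d n σc σz a + a * ε) ^ 2) := by
  set w := (a - 1) ^ 2 * (σc ^ 2 / d) + a ^ 2 * (σz ^ 2 / n) with hw
  have hw0 : 0 ≤ w := by positivity
  have hmp : MeasurePreserving (fun p => shrinkResidual a (Prod.map id W.adjoint p))
      (latentNoiseLaw d n σc σz) (isoGaussian d w) :=
    MeasurePreserving.comp (g := shrinkResidual a)
      ⟨measurable_shrinkResidual a, map_shrinkResidual d n σc σz a⟩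
      (measurePreserving_latentNoiseLaw hW σc σz)
  calc _ ≤ ∫⁻ p, ENNReal.ofReal ((‖shrinkResidual a (Prod.map id W.adjoint p)‖ + a * ε) ^ 2)
        ∂(latentNoiseLaw d n σc σz) := by
        refine lintegral_mono fun p => iSup₂_le fun e he => ?_
        rw [← ofReal_norm, ← ENNReal.ofReal_pow (norm_nonneg _)]
        apply ENNReal.ofReal_le_ofReal
        gcongr
        have : a • W (W.adjoint (W p.1 + p.2 + e)) - W p.1 =
            W (shrinkResidual a (Prod.map id W.adjoint p)) + a • W (W.adjoint e) := by
          simp only [shrinkResidual, map_add, map_smul, hW, Prod.map_fst, Prod.map_snd, id]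
          module
        rw [this]
        refine (norm_add_le _ _).trans ?_
        rw [norm_map_of_adjoint_comp hW, norm_smul, norm_map_of_adjoint_comp hW,
          Real.norm_of_nonneg ha]
        gcongr
        exact (norm_adjoint_le_of_adjoint_comp hW e).trans (by simpa using he)
    _ = ∫⁻ x, ENNReal.ofReal ((‖x‖ + a * ε) ^ 2) ∂(isoGaussian d w) :=
        hmp.lintegral_comp (f := fun x => ENNReal.ofReal ((‖x‖ + a * ε) ^ 2)) (by fun_prop)
    _ = ENNReal.ofReal (∫ x, (‖x‖ + a * ε) ^ 2 ∂(isoGaussian d w)) := by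
        refine (ofReal_integral_eq_lintegral_ofReal ?_ (ae_of_all _ fun _ => sq_nonneg _)).symm
        exact ((IsGaussian.memLp_two_id (μ := isoGaussian d w)).norm.add
          (memLp_const (a * ε))).integrable_sq
    _ ≤ _ := by
        apply ENNReal.ofReal_le_ofReal
        rw [shrinkError_eq hd]
        exact integral_norm_add_const_sq_isoGaussian_le hw0 (by positivity)

/-- Let `r` be the attacked residual of scalar shrinkage by `α` in signal coordinates, and `X` the
error of `T` under the same attack. Then `‖X‖² ≥ 2⟪W r, X⟫ - ‖r‖²` pointwise, and `E⟪W r, X⟫ =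
E‖r‖²` by symmetry, so the risk of `T` is at least `E‖r‖²`. -/
lemma le_lintegral_linear (hW : ∀ c, W.adjoint (W c) = c) (hd : 0 < d) {σc : ℝ} (hc : 0 < σc)
    (σz : ℝ) {ε : ℝ} (hε : 0 ≤ ε) (T : EuclideanSpace ℝ (Fin n) →L[ℝ] EuclideanSpace ℝ (Fin n))
    (A : Matrix (Fin d) (Fin d) ℝ) (hA : ∀ c, A.toEuclideanLin c = W.adjoint (T (W c)))
    {α : ℝ} (hα : A.trace = d * α) :
    ENNReal.ofReal ((1 - gaussianSquareVariance / (2 * d)) *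
      (shrinkError d n σc σz α + |α| * ε) ^ 2) ≤
    ∫⁻ p, ⨆ e ∈ Metric.closedBall (0 : EuclideanSpace ℝ (Fin n)) ε,
      ‖T (W p.1 + p.2 + e) - W p.1‖ₑ ^ 2 ∂(latentNoiseLaw d n σc σz) := by
  have hd' : (0 : ℝ) < d := by exact_mod_cast hd
  -- The signed radius `t` takes the sign of `α`, so the attack always lengthens the residual.
  obtain ⟨t, ht, hαt⟩ : ∃ t : ℝ, |t| = ε ∧ α * t = |α| * ε := by
    rcases le_total 0 α with h | h
    · exact ⟨ε, abs_of_nonneg hε, by rw [abs_of_nonneg h]⟩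
    · exact ⟨-ε, by rw [abs_neg, abs_of_nonneg hε], by rw [abs_of_nonpos h]; ring⟩
  have hαt0 : 0 ≤ α * t := by rw [hαt]; positivity
  set μ := latentNoiseLaw d n σc σz with hμ
  set ν := (isoGaussian d (σc ^ 2 / d)).prod (isoGaussian d (σz ^ 2 / n)) with hν
  have hΦ : MeasurePreserving (Prod.map id W.adjoint) μ ν := measurePreserving_latentNoiseLaw hW σc σz
  have hQ (Q : EuclideanSpace ℝ (Fin d) ≃ₗᵢ[ℝ] EuclideanSpace ℝ (Fin d)) :
      MeasurePreserving (Prod.map Q Q) ν ν :=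
    measurePreserving_prodMap_isoGaussian (by positivity) (by positivity) Q
  -- square-integrability
  have Lc : MemLp (fun p => p.1) 2 ν :=
    (IsGaussian.memLp_two_id (μ := isoGaussian d (σc ^ 2 / d))).comp_fst _
  have Lb : MemLp (fun p => p.2) 2 ν :=
    (IsGaussian.memLp_two_id (μ := isoGaussian d (σz ^ 2 / n))).comp_snd _
  have La : MemLp (shrinkAttack α t) 2 ν :=
    MemLp.of_bound (measurable_shrinkAttack α t).aestronglyMeasurable |t|
      (ae_of_all _ (norm_shrinkAttack_le α t))
  have Lv : MemLp (shrinkResidual α) 2 ν := (Lc.const_smul (α - 1)).add (Lb.const_smul α)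
  set r : EuclideanSpace ℝ (Fin d) × EuclideanSpace ℝ (Fin d) → EuclideanSpace ℝ (Fin d) :=
    fun p => shrinkResidual α p + α • shrinkAttack α t p with hr
  set G : EuclideanSpace ℝ (Fin d) × EuclideanSpace ℝ (Fin d) → EuclideanSpace ℝ (Fin d) :=
    fun p => p.1 + p.2 + shrinkAttack α t p with hG
  have Lr : MemLp r 2 ν := Lv.add (La.const_smul α)
  have LG : MemLp G 2 ν := (Lc.add Lb).add La
  have hrG (p) : r p = α • G p - p.1 := by
    simp only [hr, hG, shrinkResidual]; module
  -- the main term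
  have hmain : ∫ p, (⟪r p, A.toEuclideanLin (G p)⟫ - ⟪r p, p.1⟫) ∂ν = ∫ p, ‖r p‖ ^ 2 ∂ν := by
    have LAG : MemLp (fun p => A.toEuclideanLin (G p)) 2 ν :=
      (LinearMap.toContinuousLinearMap A.toEuclideanLin).comp_memLp' LG
    have key := integral_inner_toEuclideanLin_of_equivariant hQ Lr LG
      (fun Q p => by
        simp only [hr, shrinkResidual_equivariant, shrinkAttack_equivariant, map_add, map_smul])
      (fun Q p => by simp only [hG, shrinkAttack_equivariant, map_add, Prod.map_fst, Prod.map_snd]) A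
    -- As `tr A = d α`, Schur averaging replaces `A` by `α`, and `α • G - c` is `r` itself.
    rw [hα, mul_assoc] at key
    rw [integral_sub (integrable_inner_of_memLp_two Lr LAG) (integrable_inner_of_memLp_two Lr Lc),
      mul_left_cancel₀ hd'.ne' key, ← integral_const_mul,
      ← integral_sub ((integrable_inner_of_memLp_two Lr LG).const_mul α) (integrable_inner_of_memLp_two Lr Lc)]
    refine integral_congr_ae (ae_of_all _ fun p => ?_)
    simp only
    rw [← inner_smul_right, ← inner_sub_right, ← hrG, real_inner_self_eq_norm_sq]
  -- the noise orthogonal to the signal space averages out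
  set N : EuclideanSpace ℝ (Fin n) → EuclideanSpace ℝ (Fin d) :=
    fun z => W.adjoint (T (z - W (W.adjoint z))) with hN
  have hcross : ∫ p, ⟪r (Prod.map id W.adjoint p), N p.2⟫ ∂μ = 0 := by
    -- The reflection keeps `W.adjoint z`, hence `r`, and negates `N`, so the integral equals its
    -- own negative.
    have hρ := measurePreserving_latentNoiseLaw_reflection hW σc σz
    have Lx : AEStronglyMeasurable (fun p => ⟪r (Prod.map id W.adjoint p), N p.2⟫) μ :=
      (Lr.comp_measurePreserving hΦ).1.inner (by fun_prop)
    have h := integral_map hρ.measurable.aemeasurable (by rw [hρ.map_eq]; exact Lx)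
    rw [hρ.map_eq] at h
    have e (p : EuclideanSpace ℝ (Fin d) × EuclideanSpace ℝ (Fin n)) :
        ⟪r (Prod.map id W.adjoint (Prod.map id (fun z => (2 : ℝ) • W (W.adjoint z) - z) p)),
          N (Prod.map id (fun z => (2 : ℝ) • W (W.adjoint z) - z) p).2⟫ =
        -⟪r (Prod.map id W.adjoint p), N p.2⟫ := by
      have e1 : W.adjoint ((2 : ℝ) • W (W.adjoint p.2) - p.2) = W.adjoint p.2 := by
        simp only [map_sub, map_smul, hW]; module
      have e2 : N ((2 : ℝ) • W (W.adjoint p.2) - p.2) = - N p.2 := by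
        simp only [hN, e1, ← map_neg]
        congr 2
        module
      simp only [Prod.map_snd, e2, inner_neg_right, neg_inj]
      congr 2
      exact Prod.ext rfl e1
    simp_rw [e, integral_neg] at h
    linarith
  set X : EuclideanSpace ℝ (Fin d) × EuclideanSpace ℝ (Fin n) → EuclideanSpace ℝ (Fin n) :=
    fun p => T (W p.1 + p.2 + W (shrinkAttack α t (Prod.map id W.adjoint p))) - W p.1 with hX
  have hWX (p) : ⟪W (r (Prod.map id W.adjoint p)), X p⟫ =
      (⟪r (Prod.map id W.adjoint p), A.toEuclideanLin (G (Prod.map id W.adjoint p))⟫ -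
        ⟪r (Prod.map id W.adjoint p), (Prod.map id W.adjoint p).1⟫) +
      ⟪r (Prod.map id W.adjoint p), N p.2⟫ := by
    rw [← ContinuousLinearMap.adjoint_inner_right, ← inner_sub_right, ← inner_add_right, hA]
    congr 1
    simp only [hX, hN, hG, map_sub, map_add, hW, Prod.map_fst, Prod.map_snd, id]
    abel
  have LrΦ : MemLp (fun p => r (Prod.map id W.adjoint p)) 2 μ := Lr.comp_measurePreserving hΦ
  have LGΦ : MemLp (fun p => G (Prod.map id W.adjoint p)) 2 μ := LG.comp_measurePreserving hΦ
  have LcΦ : MemLp (fun p : EuclideanSpace ℝ (Fin d) × EuclideanSpace ℝ (Fin n) =>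
      (Prod.map id W.adjoint p).1) 2 μ := Lc.comp_measurePreserving hΦ
  have LN : MemLp (fun p : EuclideanSpace ℝ (Fin d) × EuclideanSpace ℝ (Fin n) => N p.2) 2 μ := by
    have := (W.adjoint ∘L T ∘L (ContinuousLinearMap.id ℝ _ - W ∘L W.adjoint)).comp_memLp'
      (IsGaussian.memLp_two_id (μ := isoGaussian n (σz ^ 2 / n)))
    exact this.comp_snd (isoGaussian d (σc ^ 2 / d))
  have I1 : Integrable (fun p =>
      ⟪r (Prod.map id W.adjoint p), A.toEuclideanLin (G (Prod.map id W.adjoint p))⟫ -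
        ⟪r (Prod.map id W.adjoint p), (Prod.map id W.adjoint p).1⟫) μ :=
    (integrable_inner_of_memLp_two LrΦ
      ((LinearMap.toContinuousLinearMap A.toEuclideanLin).comp_memLp' LGΦ)).sub
      (integrable_inner_of_memLp_two LrΦ LcΦ)
  have I2 := integrable_inner_of_memLp_two LrΦ LN
  have I3 : Integrable (fun p => ‖r (Prod.map id W.adjoint p)‖ ^ 2) μ := LrΦ.norm.integrable_sq
  have IW : Integrable (fun p => ⟪W (r (Prod.map id W.adjoint p)), X p⟫) μ := by
    rw [funext hWX]; exact I1.add I2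
  have hIr : ∫ p, ‖r (Prod.map id W.adjoint p)‖ ^ 2 ∂μ = ∫ p, ‖r p‖ ^ 2 ∂ν := by
    rw [← hΦ.map_eq, integral_map hΦ.measurable.aemeasurable]
    rw [hΦ.map_eq]
    exact Lr.norm.integrable_sq.1
  have hIW : ∫ p, ⟪W (r (Prod.map id W.adjoint p)), X p⟫ ∂μ = ∫ p, ‖r p‖ ^ 2 ∂ν := by
    rw [funext hWX, integral_add I1 I2, hcross, add_zero, ← hmain, ← hΦ.map_eq,
      integral_map hΦ.measurable.aemeasurable]
    rw [hΦ.map_eq]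
    exact ((integrable_inner_of_memLp_two Lr
      ((LinearMap.toContinuousLinearMap A.toEuclideanLin).comp_memLp' LG)).sub
      (integrable_inner_of_memLp_two Lr Lc)).1
  have hnorm : ∫ p, ‖r p‖ ^ 2 ∂ν = ∫ x, (‖x‖ + |α| * ε) ^ 2
      ∂(isoGaussian d ((α - 1) ^ 2 * (σc ^ 2 / d) + α ^ 2 * (σz ^ 2 / n))) := by
    rw [← map_shrinkResidual, integral_map (measurable_shrinkResidual α).aemeasurable (by fun_prop)]
    have hne : ∀ᵐ p ∂ν, p.1 ≠ 0 :=
      Measure.quasiMeasurePreserving_fst.ae (isoGaussian_ne_zero hd (by positivity))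
    refine integral_congr_ae (hne.mono fun p hp => ?_)
    simp only [hr]
    rw [norm_shrinkResidual_add_attack hαt0 hp, hαt]
  calc _ ≤ ENNReal.ofReal (∫ p, ‖r p‖ ^ 2 ∂ν) := by
        apply ENNReal.ofReal_le_ofReal
        rw [hnorm, shrinkError_eq hd]
        exact le_integral_norm_add_const_sq_isoGaussian hd (by positivity) (by positivity)
    _ = ENNReal.ofReal (∫ p, (2 * ⟪W (r (Prod.map id W.adjoint p)), X p⟫ -
          ‖r (Prod.map id W.adjoint p)‖ ^ 2) ∂μ) := by
        rw [integral_sub (IW.const_mul 2) I3, integral_const_mul, hIr, hIW]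
        congr 1; ring
    _ ≤ ∫⁻ p, ENNReal.ofReal (2 * ⟪W (r (Prod.map id W.adjoint p)), X p⟫ -
          ‖r (Prod.map id W.adjoint p)‖ ^ 2) ∂μ :=
        ofReal_integral_le_lintegral_ofReal ((IW.const_mul 2).sub I3)
    _ ≤ _ := by
        refine lintegral_mono fun p => ?_
        have hmem : W (shrinkAttack α t (Prod.map id W.adjoint p)) ∈
            Metric.closedBall (0 : EuclideanSpace ℝ (Fin n)) ε := by
          rw [mem_closedBall_zero_iff, norm_map_of_adjoint_comp hW, ← ht]
          exact norm_shrinkAttack_le α t _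
        refine le_trans ?_ (le_iSup₂ (f := fun e (_ : e ∈ Metric.closedBall
          (0 : EuclideanSpace ℝ (Fin n)) ε) => ‖T (W p.1 + p.2 + e) - W p.1‖ₑ ^ 2) _ hmem)
        change _ ≤ ‖X p‖ₑ ^ 2
        rw [← ofReal_norm, ← ENNReal.ofReal_pow (norm_nonneg _)]
        apply ENNReal.ofReal_le_ofReal
        -- Expanding `‖X - W r‖² ≥ 0` gives the linearized bound.
        have h := norm_sub_sq_real (X p) (W (r (Prod.map id W.adjoint p)))
        rw [norm_map_of_adjoint_comp hW, real_inner_comm] at h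
        linarith [sq_nonneg ‖X p - W (r (Prod.map id W.adjoint p))‖]

end Isometry

/-! ### Transfer to matrices and conclusion -/

lemma adjoint_toEuclideanLin_apply {m k : ℕ} (M : Matrix (Fin m) (Fin k) ℝ)
    (x : EuclideanSpace ℝ (Fin m)) :
    (LinearMap.toContinuousLinearMap M.toEuclideanLin).adjoint x = M.transpose.toEuclideanLin x := by
  rw [← Matrix.conjTranspose_eq_transpose_of_trivial, Matrix.toEuclideanLin_conjTranspose_eq_adjoint]
  rfl

lemma toEuclideanLin_mul_apply {l m k : ℕ} (M : Matrix (Fin l) (Fin m) ℝ)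
    (N : Matrix (Fin m) (Fin k) ℝ) (x : EuclideanSpace ℝ (Fin k)) :
    (M * N).toEuclideanLin x = M.toEuclideanLin (N.toEuclideanLin x) := by
  simp [Matrix.toLpLin_apply]

lemma adjoint_comp_toEuclideanLin {d n : ℕ} {U : Matrix (Fin n) (Fin d) ℝ}
    (hU : U.transpose * U = 1) (c : EuclideanSpace ℝ (Fin d)) :
    (LinearMap.toContinuousLinearMap U.toEuclideanLin).adjoint
      (LinearMap.toContinuousLinearMap U.toEuclideanLin c) = c := by
  rw [adjoint_toEuclideanLin_apply, LinearMap.coe_toContinuousLinearMap',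
    ← toEuclideanLin_mul_apply, hU]
  simp

lemma robustRisk_shrinkage_le {d n : ℕ} {U : Matrix (Fin n) (Fin d) ℝ}
    (hU : U.transpose * U = 1) (hd : 0 < d) (σc σz : ℝ) {ε a : ℝ} (hε : 0 ≤ ε) (ha : 0 ≤ a) :
    robustRisk U σc σz ε (linearEstimator (a • (U * U.transpose))) ≤
      ENNReal.ofReal ((shrinkError d n σc σz a + a * ε) ^ 2) := by
  refine le_trans (le_of_eq ?_) (lintegral_shrinkage_le (adjoint_comp_toEuclideanLin hU) hd σc σz hε ha)
  simp only [robustRisk, linearEstimator, map_smul, LinearMap.smul_apply, toEuclideanLin_mul_apply,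
    adjoint_toEuclideanLin_apply, LinearMap.coe_toContinuousLinearMap']

lemma le_robustRisk_linearEstimator {d n : ℕ} {U : Matrix (Fin n) (Fin d) ℝ}
    (hU : U.transpose * U = 1) (hd : 0 < d) {σc : ℝ} (hc : 0 < σc) (σz : ℝ) {ε : ℝ} (hε : 0 ≤ ε)
    (H : Matrix (Fin n) (Fin n) ℝ) :
    ∃ α : ℝ, ENNReal.ofReal ((1 - gaussianSquareVariance / (2 * d)) *
      (shrinkError d n σc σz α + |α| * ε) ^ 2) ≤ robustRisk U σc σz ε (linearEstimator H) := by
  have hd' : (d : ℝ) ≠ 0 := by exact_mod_cast hd.ne'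
  refine ⟨(U.transpose * (H * U)).trace / d, ?_⟩
  refine le_lintegral_linear (adjoint_comp_toEuclideanLin hU) hd hc σz hε
    (LinearMap.toContinuousLinearMap H.toEuclideanLin) (U.transpose * (H * U)) (fun c => ?_)
    (by field_simp)
  simp only [toEuclideanLin_mul_apply, adjoint_toEuclideanLin_apply,
    LinearMap.coe_toContinuousLinearMap']

end RobustDenoising

theorem corollary1 (δ : ℝ) (hδ : 0 < δ) :
    ∃ D : ℕ, ∀ (d n : ℕ) (σc σz ε : ℝ) (U : Matrix (Fin n) (Fin d) ℝ),
      0 < d → U.transpose * U = 1 → 0 < σc → 0 ≤ σz → 0 ≤ ε → ε ^ 2 < σc ^ 2 →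
      ∀ (σw : ℝ) (Hj : Matrix (Fin n) (Fin n) ℝ),
      σw = RobustDenoising.jitterLevel d n σc σz ε →
      Hj = RobustDenoising.jitterShrinkage d n σc σz σw • (U * U.transpose) →
        RobustDenoising.IsJitteringMinimizer U σc σz σw Hj ∧
        (0 < σz → ∀ H : Matrix (Fin n) (Fin n) ℝ,
          RobustDenoising.IsJitteringMinimizer U σc σz σw H → H = Hj) ∧
        RobustDenoising.jitterShrinkage d n σc σz σw =
          RobustDenoising.robustShrinkage d n σc σz ε ∧
        (D ≤ d → ∀ H : Matrix (Fin n) (Fin n) ℝ, H.IsSymm →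
          RobustDenoising.robustRisk U σc σz ε (RobustDenoising.linearEstimator Hj) ≤
            ENNReal.ofReal (1 + δ) *
              RobustDenoising.robustRisk U σc σz ε (RobustDenoising.linearEstimator H)) := by
  -- This threshold is the condition `(1 + δ)(1 - K/(2d)) ≥ 1` solved for `d`, with `K =
  -- gaussianSquareVariance`.
  obtain ⟨D, hD⟩ := exists_nat_ge (RobustDenoising.gaussianSquareVariance * (1 + δ) / (2 * δ))
  refine ⟨D, fun d n σc σz ε U hd hU hc hz hε hεc σw Hj hσw hHj => ?_⟩
  have hn : 0 < n := by
    rcases Nat.eq_zero_or_pos n with rfl | hn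
    · have h := congrFun (congrFun hU ⟨0, hd⟩) ⟨0, hd⟩
      simp [Matrix.mul_apply] at h
    · exact hn
  have hshr : RobustDenoising.jitterShrinkage d n σc σz σw =
      RobustDenoising.robustShrinkage d n σc σz ε := by
    rw [hσw]; exact RobustDenoising.jitterShrinkage_eq_robustShrinkage hd hc hz hε hεc
  refine ⟨hHj ▸ RobustDenoising.isJitteringMinimizer_shrinkage hd hU hc σz σw,
    fun hz' H hH => hHj ▸ hH.eq_shrinkage hd hn hU hc hz', hshr, fun hDd H _ => ?_⟩
  obtain ⟨ha, hopt⟩ := RobustDenoising.robustShrinkage_optimal (d := d) (n := n) hc hz hε hεc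
  obtain ⟨α, hα⟩ := RobustDenoising.le_robustRisk_linearEstimator hU hd hc σz hε H
  rw [hHj, hshr]
  refine (RobustDenoising.robustRisk_shrinkage_le hU hd σc σz hε ha).trans ?_
  refine le_trans ?_ (mul_le_mul_right hα _)
  rw [← ENNReal.ofReal_mul (by positivity), ← mul_assoc]
  apply ENNReal.ofReal_le_ofReal
  have hd' : (0 : ℝ) < d := by exact_mod_cast hd
  have hη : 1 ≤ (1 + δ) * (1 - RobustDenoising.gaussianSquareVariance / (2 * d)) := by
    have h1 : RobustDenoising.gaussianSquareVariance * (1 + δ) / (2 * δ) ≤ d :=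
      hD.trans (by exact_mod_cast hDd)
    rw [div_le_iff₀ (by positivity)] at h1
    have h2 : (1 + δ) * (RobustDenoising.gaussianSquareVariance / (2 * d)) ≤ δ := by
      rw [← mul_div_assoc, div_le_iff₀ (by positivity)]
      linarith
    linarith
  have h0 : 0 ≤ RobustDenoising.shrinkError d n σc σz
      (RobustDenoising.robustShrinkage d n σc σz ε) +
      RobustDenoising.robustShrinkage d n σc σz ε * ε :=
    add_nonneg (Real.sqrt_nonneg _) (mul_nonneg ha hε)
  exact (pow_le_pow_left₀ h0 (hopt α) 2).trans (le_mul_of_one_le_left (sq_nonneg _) hη)
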